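/- For real sequences write $\mathrm{K}_{n=1}^{\infty}\left(\frac{a_n}{b_n}\right)=\cfrac{a_1}{b_1+\cfrac{a_2}{b_2+\cdots}}$ and $\mathrm{TK}_{n=1}^{\infty}\left(\frac{a_n}{b_n}\,{\scriptstyle+}\,\frac{c_n}{d_n}\right)=\cfrac{a_1}{b_1+\cfrac{c_1}{d_1+\cfrac{a_2}{b_2+\cfrac{c_2}{d_2+\cdots}}}}$ for the values (limits of convergents) of these infinite continued fractions. (i) Let $\psi$ be an arbitrary real-valued function of $r$, let $\varphi(s,r)=s+\psi(r)$ and $$f(s,r)=\frac{1}{\varphi(s,r)+\mathrm{K}_{n=1}^{\infty}\left(\frac{n^2r^2}{\varphi(s,r)}\right)}.$$ Then for all $r>0$ and $s>r-\psi(r)$ the continued fractions involved converge, the denominators do not vanish, $f(\cdot,r)$ is differentiable at $s$, and $$\frac{\partial}{\partial s}f(s,r)=-\frac{1}{\varphi^2(s,r)-r^2+\mathrm{TK}_{n=1}^{\infty}\left(\frac{4n^2r^2}{1}\,{\scriptstyle+}\,\frac{4n^2r^2}{\varphi^2(s,r)-r^2}\right)}.$$ (ii) Let $$f_1(s,r)=\frac{1}{2-2r+2s+2\,\mathrm{K}_{n=1}^{\infty}\left(\frac{n^2r^2}{1-r+s}\right)},\qquad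 f_2(s,r)=\frac{1}{2r-2+2s+2\,\mathrm{K}_{n=1}^{\infty}\left(\frac{n^2r^2}{r-1+s}\right)}.$$ Then for all $r>0$ and $s>\max(1,2r-1)$ the continued fractions involved converge, the denominators do not vanish, $f_1(\cdot,r)$ and $f_2(\cdot,r)$ are differentiable at $s$, and $$\frac{\partial}{\partial s}f_1(s,r)=-\frac{1}{2(1-2r+s)(1+s)+2\,\mathrm{TK}_{n=1}^{\infty}\left(\frac{4n^2r^2}{1}\,{\scriptstyle+}\,\frac{4n^2r^2}{(1-2r+s)(1+s)}\right)},$$ $$\frac{\partial}{\partial s}f_2(s,r)=-\frac{1}{2(2r-1+s)(s-1)+2\,\mathrm{TK}_{n=1}^{\infty}\left(\frac{4n^2r^2}{1}\,{\scriptstyle+}\,\frac{4n^2r^2}{(2r-1+s)(s-1)}\right)}.$$ -/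

import Mathlib

open Filter Topology

/-- The infinite continued fraction
`K_{n ≥ 1} (a n / b n) = a 1 / (b 1 + a 2 / (b 2 + a 3 / (b 3 + ⋯)))`, with head term `0`. -/
def contFracK (a b : ℕ → ℝ) : GenContFract ℝ where
  h := 0
  s := Stream'.Seq.ofStream (fun k : ℕ => ⟨a (k + 1), b (k + 1)⟩)

/-- The infinite continued fraction with two interleaved families of partial fractions
`TK_{n ≥ 1} (a n / b n + c n / d n)
  = a 1 / (b 1 + c 1 / (d 1 + a 2 / (b 2 + c 2 / (d 2 + ⋯))))`, with head term `0`. -/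
def contFracTK (a b c d : ℕ → ℝ) : GenContFract ℝ where
  h := 0
  s := Stream'.Seq.ofStream (fun k : ℕ =>
    if k % 2 = 0 then ⟨a (k / 2 + 1), b (k / 2 + 1)⟩ else ⟨c (k / 2 + 1), d (k / 2 + 1)⟩)

/-- A continued fraction converges to `v` if all but finitely many of its convergents `Aₙ / Bₙ`
are defined (`Bₙ ≠ 0`) and they tend to the real number `v`. -/
def CFConvergesTo (g : GenContFract ℝ) (v : ℝ) : Prop :=
  (∀ᶠ n : ℕ in atTop, g.dens n ≠ 0) ∧ Tendsto (fun n : ℕ => g.convs n) atTop (𝓝 v)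

/-- A continued fraction converges if it converges to some real number. -/
def CFConverges (g : GenContFract ℝ) : Prop :=
  ∃ v : ℝ, CFConvergesTo g v

/-- The value of a continued fraction: the limit of its convergents
(meaningful when `CFConverges g` holds). -/
noncomputable def cfValue (g : GenContFract ℝ) : ℝ :=
  limUnder atTop (fun n : ℕ => g.convs n)

/-- The continued fraction `K_{n ≥ 1} (n² r² / x)`. -/
def cfA (x r : ℝ) : GenContFract ℝ :=
  contFracK (fun n => (n : ℝ) ^ 2 * r ^ 2) (fun _ => x)

/-- The continued fraction `TK_{n ≥ 1} (4 n² r² / 1 + 4 n² r² / z)`. -/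
def cfB (z r : ℝ) : GenContFract ℝ :=
  contFracTK (fun n => 4 * (n : ℝ) ^ 2 * r ^ 2) (fun _ => 1)
    (fun n => 4 * (n : ℝ) ^ 2 * r ^ 2) (fun _ => z)

/-! Put `F x = 1 / (x + K(n²r²/x))` and `h x = 1 / (x² - r² + TK)`. Both tend to `0` at infinity,
and `F x + F (x + 2r) = 2/(x + r)`, `h x + h (x + 2r) = 2/(x + r)²` (`shift_equation_cfA`,
`shift_equation_cfB`). Iterating the first writes `F` as a series of differences of simple
fractions. Differentiating it termwise gives minus the series that the second yields for `h`, so `F'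
= -h` for `x > r` (`hasDerivAt_of_shift_equations`).

The shift equations rest on a Pincherle-type fact: a convergent fraction with positive elements has
value `W 1 / W 0` for every positive solution `W` of `a n * W n = b n * W (n+1) + W (n+2)`. A
positive solution at `x + 2r` is turned into one at `x` by an explicit two-term combination, so the
two values are linked algebraically. -/

/-- The infinite continued fraction `a 0 / (b 0 + a 1 / (b 1 + ⋯))`. -/
def seqContFract (a b : ℕ → ℝ) : GenContFract ℝ where
  h := 0
  s := Stream'.Seq.ofStream (fun k : ℕ => ⟨a k, b k⟩)

/-! ### Fractions with positive elements: recurrences and determinant. -/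

namespace seqContFract

variable {a b : ℕ → ℝ}

@[simp]
theorem h_eq_zero : (seqContFract a b).h = 0 := rfl

theorem nums_zero : (seqContFract a b).nums 0 = 0 := rfl

theorem dens_zero : (seqContFract a b).dens 0 = 1 := rfl

theorem nums_one : (seqContFract a b).nums 1 = a 0 := by
  have h := GenContFract.first_num_eq (g := seqContFract a b) (gp := ⟨a 0, b 0⟩) rfl
  simpa [seqContFract] using h

theorem dens_one : (seqContFract a b).dens 1 = b 0 :=
  GenContFract.first_den_eq (g := seqContFract a b) (gp := ⟨a 0, b 0⟩) rfl

theorem nums_add_two (n : ℕ) : (seqContFract a b).nums (n + 2) =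
    b (n + 1) * (seqContFract a b).nums (n + 1) + a (n + 1) * (seqContFract a b).nums n :=
  GenContFract.nums_recurrence (gp := ⟨a (n + 1), b (n + 1)⟩) rfl rfl rfl

theorem dens_add_two (n : ℕ) : (seqContFract a b).dens (n + 2) =
    b (n + 1) * (seqContFract a b).dens (n + 1) + a (n + 1) * (seqContFract a b).dens n :=
  GenContFract.dens_recurrence (gp := ⟨a (n + 1), b (n + 1)⟩) rfl rfl rfl

theorem determinant (n : ℕ) :
    (seqContFract a b).nums (n + 1) * (seqContFract a b).dens n -
      (seqContFract a b).nums n * (seqContFract a b).dens (n + 1) =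
      (-1) ^ n * ∏ k ∈ Finset.range (n + 1), a k := by
  induction n with
  | zero => simp [nums_one]
  | succ n ih =>
    rw [Finset.prod_range_succ, nums_add_two, dens_add_two, pow_succ]
    linear_combination (-a (n + 1)) * ih

theorem dens_pos (ha : ∀ n, 0 < a n) (hb : ∀ n, 0 < b n) (n : ℕ) :
    0 < (seqContFract a b).dens n := by
  induction n using Nat.twoStepInduction with
  | zero => simp
  | one => rw [dens_one]; exact hb 0
  | more n h₀ h₁ =>
    rw [dens_add_two]
    exact add_pos (mul_pos (hb _) h₁) (mul_pos (ha _) h₀)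

/-! ### Convergence as an alternating series. -/

/-- The reciprocal of the distance between consecutive convergents. -/
noncomputable def invGap (a b : ℕ → ℝ) (n : ℕ) : ℝ :=
  (seqContFract a b).dens (n + 1) * (seqContFract a b).dens n / ∏ k ∈ Finset.range (n + 1), a k

theorem invGap_pos (ha : ∀ n, 0 < a n) (hb : ∀ n, 0 < b n) (n : ℕ) : 0 < invGap a b n :=
  div_pos (mul_pos (dens_pos ha hb _) (dens_pos ha hb _)) (Finset.prod_pos fun _ _ => ha _)

/-- The increment is positive, so the gaps decrease, and they vanish in the limit once the
increments have divergent sum. -/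
theorem invGap_succ (ha : ∀ n, 0 < a n) (n : ℕ) : invGap a b (n + 1) = invGap a b n +
    b (n + 1) * (seqContFract a b).dens (n + 1) ^ 2 / ∏ k ∈ Finset.range (n + 2), a k := by
  have h₀ : 0 < ∏ k ∈ Finset.range (n + 1), a k := Finset.prod_pos fun _ _ => ha _
  have h₁ := ha (n + 1)
  rw [invGap, invGap, Finset.prod_range_succ _ (n + 1), dens_add_two]
  field_simp
  ring

theorem convs_succ_sub (ha : ∀ n, 0 < a n) (hb : ∀ n, 0 < b n) (n : ℕ) :
    (seqContFract a b).convs (n + 1) - (seqContFract a b).convs n =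
      (-1) ^ n * (invGap a b n)⁻¹ := by
  have h₀ := (dens_pos ha hb n).ne'
  have h₁ := (dens_pos ha hb (n + 1)).ne'
  rw [GenContFract.conv_eq_num_div_den, GenContFract.conv_eq_num_div_den, invGap, inv_div,
    div_sub_div _ _ h₁ h₀, ← mul_div_assoc, ← determinant]
  ring

theorem convs_eq_sum (ha : ∀ n, 0 < a n) (hb : ∀ n, 0 < b n) (n : ℕ) :
    (seqContFract a b).convs n = ∑ k ∈ Finset.range n, (-1) ^ k * (invGap a b k)⁻¹ := by
  simp_rw [← convs_succ_sub ha hb]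
  have h := Finset.sum_range_sub (fun k => (seqContFract a b).convs k) n
  simpa using h.symm

theorem antitone_inv_invGap (ha : ∀ n, 0 < a n) (hb : ∀ n, 0 < b n) :
    Antitone fun n => (invGap a b n)⁻¹ := by
  refine antitone_nat_of_succ_le fun n => inv_anti₀ (invGap_pos ha hb n) ?_
  rw [invGap_succ ha]
  have h : 0 < ∏ k ∈ Finset.range (n + 2), a k := Finset.prod_pos fun _ _ => ha _
  have := hb (n + 1)
  have := dens_pos ha hb (n + 1)
  have : 0 < b (n + 1) * (seqContFract a b).dens (n + 1) ^ 2 /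
    ∏ k ∈ Finset.range (n + 2), a k := by positivity
  linarith

theorem tendsto_invGap_of_not_summable (ha : ∀ n, 0 < a n) (hb : ∀ n, 0 < b n) {d : ℕ → ℝ}
    (hd₀ : ∀ n, 0 ≤ d n) (hd : ¬ Summable d)
    (hle : ∀ n, d n ≤ b (n + 1) * (seqContFract a b).dens (n + 1) ^ 2 /
      ∏ k ∈ Finset.range (n + 2), a k) :
    Tendsto (invGap a b) atTop atTop := by
  refine tendsto_atTop_mono (fun n => ?_)
    ((not_summable_iff_tendsto_nat_atTop_of_nonneg hd₀).1 hd)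
  induction n with
  | zero => simpa using (invGap_pos ha hb 0).le
  | succ n ih =>
    rw [Finset.sum_range_succ, invGap_succ ha]
    exact add_le_add ih (hle n)

theorem tendsto_convs (ha : ∀ n, 0 < a n) (hb : ∀ n, 0 < b n)
    (hE : Tendsto (invGap a b) atTop atTop) :
    ∃ v, Tendsto (seqContFract a b).convs atTop (𝓝 v) := by
  obtain ⟨v, hv⟩ := (antitone_inv_invGap ha hb).tendsto_alternating_series_of_tendsto_zero
    hE.inv_tendsto_atTop
  exact ⟨v, hv.congr fun n => (convs_eq_sum ha hb n).symm⟩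

/-! ### Positive solutions and the value of the fraction. -/

/-- A positive solution of the three-term recurrence of a continued fraction. -/
structure IsPosSol (a b W : ℕ → ℝ) : Prop where
  pos : ∀ n, 0 < W n
  rec_eq : ∀ n, a n * W n = b n * W (n + 1) + W (n + 2)

theorem IsPosSol.remainder {W : ℕ → ℝ} (hW : IsPosSol a b W) (n : ℕ) :
    W 1 * (seqContFract a b).dens n - W 0 * (seqContFract a b).nums n = (-1) ^ n * W (n + 1) := by
  induction n using Nat.twoStepInduction with
  | zero => simp
  | one => rw [dens_one, nums_one]; linear_combination -hW.rec_eq 0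
  | more n h₀ h₁ =>
    rw [dens_add_two, nums_add_two]
    have := hW.rec_eq (n + 1)
    rw [pow_succ, pow_succ] at *
    linear_combination b (n + 1) * h₁ + a (n + 1) * h₀ + (-1) ^ n * this

/-- By `remainder`, `W 1 / W 0` lies above the even convergents and below the odd ones, which share
the limit `v`. -/
theorem IsPosSol.limit_eq {W : ℕ → ℝ} (hW : IsPosSol a b W) (ha : ∀ n, 0 < a n)
    (hb : ∀ n, 0 < b n) {v : ℝ} (hv : Tendsto (seqContFract a b).convs atTop (𝓝 v)) :
    v = W 1 / W 0 := by
  have key : ∀ n, W 1 / W 0 - (seqContFract a b).convs n =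
      (-1) ^ n * (W (n + 1) / (W 0 * (seqContFract a b).dens n)) := fun n => by
    have h₀ := (hW.pos 0).ne'
    have h₁ := (dens_pos ha hb n).ne'
    rw [GenContFract.conv_eq_num_div_den, div_sub_div _ _ h₀ h₁, hW.remainder, mul_div_assoc]
  have hpos : ∀ n, 0 < W (n + 1) / (W 0 * (seqContFract a b).dens n) := fun n =>
    div_pos (hW.pos _) (mul_pos (hW.pos _) (dens_pos ha hb n))
  apply le_antisymm
  · refine le_of_tendsto (hv.comp (tendsto_id.const_mul_atTop' (r := 2) two_pos))
      (Eventually.of_forall fun n => ?_)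
    have h := key (2 * n)
    rw [pow_mul, neg_one_sq, one_pow, one_mul] at h
    have := hpos (2 * n)
    simp only [Function.comp, id]
    linarith
  · have hodd : Tendsto (fun n : ℕ => 2 * n + 1) atTop atTop :=
      tendsto_atTop_mono (fun n => by simp only [id]; omega) tendsto_id
    refine ge_of_tendsto (hv.comp hodd) (Eventually.of_forall fun n => ?_)
    have h := key (2 * n + 1)
    rw [pow_succ, pow_mul, neg_one_sq, one_pow] at h
    have := hpos (2 * n + 1)
    simp only [Function.comp]
    linarith

theorem exists_isPosSol (ha : ∀ n, 0 < a n) (hb : ∀ n, 0 < b n) {v : ℝ}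
    (hv : Tendsto (seqContFract a b).convs atTop (𝓝 v)) : ∃ W, IsPosSol a b W := by
  set A := (seqContFract a b).nums
  set B := (seqContFract a b).dens
  have hB : ∀ n, 0 < B n := dens_pos ha hb
  -- The signed remainders of `v`, normalised by `W 0 = 1`, so that `W 1 = v`.
  set W : ℕ → ℝ := fun n => Nat.casesOn n 1 fun n => (-1) ^ n * (v * B n - A n)
  have hW₀ : W 0 = 1 := rfl
  have hWs : ∀ n, W (n + 1) = (-1) ^ n * (v * B n - A n) := fun _ => rfl
  have hrec : ∀ n, a n * W n = b n * W (n + 1) + W (n + 2)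
    | 0 => by
      rw [hWs, hWs, hW₀]
      simp only [A, B, zero_add, nums_zero, dens_zero, nums_one, dens_one]
      ring
    | n + 1 => by
      rw [hWs, hWs, hWs]
      simp only [A, B, nums_add_two, dens_add_two]
      ring
  have hsum : Tendsto (fun n => ∑ k ∈ Finset.range n, (-1) ^ k * (invGap a b k)⁻¹) atTop (𝓝 v) :=
    hv.congr (convs_eq_sum ha hb)
  have hnonneg : ∀ n, 0 ≤ W (n + 1) := fun n => by
    have hc : v * B n - A n = B n * (v - (seqContFract a b).convs n) := by
      rw [GenContFract.conv_eq_num_div_den, mul_sub, mul_div_cancel₀ _ (hB n).ne']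
      ring
    rw [hWs, hc]
    rcases Nat.even_or_odd' n with ⟨k, rfl | rfl⟩
    · have := (antitone_inv_invGap ha hb).alternating_series_le_tendsto hsum k
      rw [← convs_eq_sum ha hb] at this
      rw [pow_mul, neg_one_sq, one_pow, one_mul]
      exact mul_nonneg (hB _).le (sub_nonneg.2 this)
    · have := (antitone_inv_invGap ha hb).tendsto_le_alternating_series hsum k
      rw [← convs_eq_sum ha hb] at this
      rw [pow_succ, pow_mul, neg_one_sq, one_pow]
      have := mul_nonneg (hB (2 * k + 1)).le (sub_nonneg.2 this)
      linarith
  have hgap : ∀ n, W (n + 1) * B (n + 1) + W (n + 2) * B n =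
      ∏ k ∈ Finset.range (n + 1), a k := fun n => by
    have h := determinant (a := a) (b := b) n
    have hs : ((-1 : ℝ) ^ n) * (-1) ^ n = 1 := by rw [← mul_pow]; simp
    rw [hWs, hWs]
    linear_combination (-1) ^ n * h + (∏ k ∈ Finset.range (n + 1), a k) * hs
  refine ⟨W, fun n => ?_, hrec⟩
  cases n with
  | zero => simp [hW₀]
  | succ n =>
    refine (hnonneg n).lt_of_ne fun h0 => ?_
    -- By nonnegativity and the recurrence, one zero forces the next; two in a row contradict
    -- `hgap`.
    have h1 : W (n + 2) = 0 := by
      have h := hrec (n + 1)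
      rw [← h0, mul_zero] at h
      have h2 := hnonneg (n + 2)
      have h3 := mul_nonneg (hb (n + 1)).le (hnonneg (n + 1))
      exact (mul_eq_zero.1 (by linarith : b (n + 1) * W (n + 2) = 0)).resolve_left (hb _).ne'
    have h := hgap n
    rw [← h0, h1] at h
    have : 0 < ∏ k ∈ Finset.range (n + 1), a k := Finset.prod_pos fun _ _ => ha _
    linarith

/-- A continued fraction with positive elements whose gaps tend to zero converges, and its value
is given by any positive solution of its recurrence. -/
theorem converges_and_value (ha : ∀ n, 0 < a n) (hb : ∀ n, 0 < b n)
    (hE : Tendsto (invGap a b) atTop atTop) :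
    CFConverges (seqContFract a b) ∧ (∃ W, IsPosSol a b W) ∧
      ∀ W, IsPosSol a b W → cfValue (seqContFract a b) = W 1 / W 0 := by
  obtain ⟨v, hv⟩ := tendsto_convs ha hb hE
  refine ⟨⟨v, Eventually.of_forall fun n => (dens_pos ha hb n).ne', hv⟩,
    exists_isPosSol ha hb hv, fun W hW => ?_⟩
  rw [← hW.limit_eq ha hb hv]
  exact hv.limUnder_eq

end seqContFract

/-! ### Shift equations determine the derivative. -/

/-- A function on the positive half-line with `F x + F (x + 2 r) = 2 / (x + r)` and limit `0`
at infinity is differentiable, and minus its derivative is the function `h` with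
`h x + h (x + 2 r) = 2 / (x + r) ^ 2` and limit `0` at infinity. -/
theorem hasDerivAt_of_shift_equations {r x : ℝ} (hr : 0 < r) (hx : r < x) {F h : ℝ → ℝ}
    (hF : ∀ y, 0 < y → F y + F (y + 2 * r) = 2 / (y + r))
    (hF₀ : Tendsto F atTop (𝓝 0))
    (hh : ∀ y, r < y → h y + h (y + 2 * r) = 2 / (y + r) ^ 2)
    (hh₀ : Tendsto h atTop (𝓝 0)) :
    HasDerivAt F (-h x) x := by
  set g : ℕ → ℝ → ℝ := fun k y => 2 / (y + (r + 4 * r * k)) - 2 / (y + (3 * r + 4 * r * k))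
  set g' : ℕ → ℝ → ℝ := fun k y =>
    -(2 / (y + (r + 4 * r * k)) ^ 2 - 2 / (y + (3 * r + 4 * r * k)) ^ 2)
  have shift : ∀ y : ℝ, Tendsto (fun n : ℕ => y + 4 * r * n) atTop atTop := fun y =>
    tendsto_atTop_add_const_left _ _
      (tendsto_natCast_atTop_atTop.const_mul_atTop (by positivity))
  have hFsum : ∀ y, 0 < y → HasSum (fun k => g k y) (F y) := fun y hy => by
    rw [hasSum_iff_tendsto_nat_of_nonneg]
    · have hps : ∀ n : ℕ, ∑ k ∈ Finset.range n, g k y = F y - F (y + 4 * r * n) := fun n => by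
        induction n with
        | zero => simp
        | succ n ih =>
          have hy' : 0 < y + 4 * r * n := by positivity
          have h₁ := hF (y + 4 * r * n) hy'
          have h₂ := hF (y + 4 * r * n + 2 * r) (by positivity)
          rw [Finset.sum_range_succ, ih]
          simp only [g]
          rw [show y + (r + 4 * r * n) = y + 4 * r * n + r by ring, ← h₁,
            show y + (3 * r + 4 * r * n) = y + 4 * r * n + 2 * r + r by ring, ← h₂]
          push_cast
          rw [show y + 4 * r * (n + 1 : ℝ) = y + 4 * r * n + 2 * r + 2 * r by ring]
          ring
      simp_rw [hps]
      simpa using (hF₀.comp (shift y)).const_sub (F y)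
    · intro k
      simp only [g]
      rw [sub_nonneg]
      apply div_le_div_of_nonneg_left <;> first | positivity | linarith
  have hg'neg : ∀ k y, 0 < y → 0 ≤ 2 / (y + (r + 4 * r * k)) ^ 2 -
      2 / (y + (3 * r + 4 * r * (k : ℕ))) ^ 2 := fun k y hy => by
    rw [sub_nonneg]
    apply div_le_div_of_nonneg_left <;> first | positivity | skip
    apply pow_le_pow_left₀ <;> first | positivity | linarith
  have hhsum : HasSum (fun k => -g' k x) (h x) := by
    have hx₀ : 0 < x := hr.trans hx
    rw [hasSum_iff_tendsto_nat_of_nonneg]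
    · have hps : ∀ n : ℕ, ∑ k ∈ Finset.range n, -g' k x = h x - h (x + 4 * r * n) := fun n => by
        induction n with
        | zero => simp
        | succ n ih =>
          have hn : 0 ≤ 4 * r * n := by positivity
          have h₁ := hh (x + 4 * r * n) (by linarith)
          have h₂ := hh (x + 4 * r * n + 2 * r) (by linarith)
          rw [Finset.sum_range_succ, ih]
          simp only [g', neg_neg]
          rw [show x + (r + 4 * r * n) = x + 4 * r * n + r by ring, ← h₁,
            show x + (3 * r + 4 * r * n) = x + 4 * r * n + 2 * r + r by ring, ← h₂]
          push_cast
          rw [show x + 4 * r * (n + 1 : ℝ) = x + 4 * r * n + 2 * r + 2 * r by ring]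
          ring
      simp_rw [hps]
      simpa using (hh₀.comp (shift x)).const_sub (h x)
    · intro k
      simpa only [g', neg_neg] using hg'neg k x hx₀
  -- Uniform majorant of the derivatives on `y > 0`, from `y + r + 4rk ≥ r(k + 1)`.
  have hu : Summable fun k : ℕ => 2 / r ^ 2 * (1 / ((k + 1 : ℕ) : ℝ) ^ 2) :=
    ((summable_nat_add_iff 1).2 (Real.summable_one_div_nat_pow.2 one_lt_two)).mul_left _
  have hderiv := hasDerivAt_tsum_of_isPreconnected (g := g) (g' := g') (t := Set.Ioi 0)
    (y₀ := x) (y := x) hu isOpen_Ioi isPreconnected_Ioi ?_ ?_ (hr.trans hx)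
    (hFsum x (hr.trans hx)).summable (hr.trans hx)
  · have hval : ∑' k, g' k x = -h x := by
      have := hhsum.neg
      simp only [neg_neg] at this
      exact this.tsum_eq
    rw [hval] at hderiv
    refine hderiv.congr_of_eventuallyEq ?_
    filter_upwards [lt_mem_nhds (hr.trans hx)] with y hy
    exact (hFsum y hy).tsum_eq.symm
  · intro k y hy
    have hy : 0 < y := hy
    have key : ∀ c : ℝ, 0 < c → HasDerivAt (fun y => 2 / (y + c)) (-(2 / (y + c) ^ 2)) y :=
      fun c hc => by
        have h := (hasDerivAt_const y (2 : ℝ)).fun_div ((hasDerivAt_id y).add_const c)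
          (show id y + c ≠ 0 by simp only [id]; positivity)
        simp only [id, zero_mul, mul_one, zero_sub, neg_div] at h
        exact h
    have h := (key (r + 4 * r * k) (by positivity)).fun_sub
      (key (3 * r + 4 * r * k) (by positivity))
    simp only [g, g']
    convert h using 1
    ring
  · intro k y hy
    have hy : 0 < y := hy
    simp only [g', norm_neg, Real.norm_eq_abs]
    rw [abs_of_nonneg (hg'neg k y hy)]
    have h₁ : 0 ≤ 2 / (y + (3 * r + 4 * r * (k : ℝ))) ^ 2 := by positivity
    have h₂ : 2 / (y + (r + 4 * r * (k : ℝ))) ^ 2 ≤ 2 / (r * (k + 1 : ℕ)) ^ 2 := by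
      apply div_le_div_of_nonneg_left <;> first | positivity | skip
      apply pow_le_pow_left₀ <;> first | positivity | skip
      push_cast
      nlinarith [mul_nonneg hr.le (Nat.cast_nonneg (α := ℝ) k)]
    have h₃ : 2 / r ^ 2 * (1 / ((k + 1 : ℕ) : ℝ) ^ 2) = 2 / (r * (k + 1 : ℕ)) ^ 2 := by
      rw [mul_pow, div_mul_div_comm, mul_one]
    linarith

/-! ### Convergence of the two fractions. -/

open seqContFract

/-- The partial numerators of `cfA x r`, indexed from `0`. -/
def numA (r : ℝ) (k : ℕ) : ℝ := ((k + 1 : ℕ) : ℝ) ^ 2 * r ^ 2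

/-- The partial numerators of `cfB z r`, indexed from `0`. -/
def numB (r : ℝ) (k : ℕ) : ℝ := 4 * ((k / 2 + 1 : ℕ) : ℝ) ^ 2 * r ^ 2

/-- The partial denominators of `cfB z r`, indexed from `0`. -/
def denB (z : ℝ) (k : ℕ) : ℝ := if k % 2 = 0 then 1 else z

theorem cfB_eq (z r : ℝ) : cfB z r = seqContFract (numB r) (denB z) := by
  have h : (fun k : ℕ => if k % 2 = 0 then
      (⟨4 * ((k / 2 + 1 : ℕ) : ℝ) ^ 2 * r ^ 2, 1⟩ : GenContFract.Pair ℝ)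
      else ⟨4 * ((k / 2 + 1 : ℕ) : ℝ) ^ 2 * r ^ 2, z⟩) = fun k => ⟨numB r k, denB z k⟩ := by
    funext k
    unfold numB denB
    split_ifs <;> rfl
  unfold cfB contFracTK seqContFract
  rw [h]

theorem numA_pos {r : ℝ} (hr : 0 < r) (k : ℕ) : 0 < numA r k := by
  unfold numA; positivity

theorem numB_pos {r : ℝ} (hr : 0 < r) (k : ℕ) : 0 < numB r k := by
  unfold numB; positivity

theorem denB_pos {z : ℝ} (hz : 0 < z) (k : ℕ) : 0 < denB z k := by
  unfold denB; split_ifs <;> positivity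

theorem numB_two_mul (r : ℝ) (n : ℕ) : numB r (2 * n) = 4 * ((n : ℝ) + 1) ^ 2 * r ^ 2 := by
  simp [numB]

theorem numB_two_mul_add_one (r : ℝ) (n : ℕ) :
    numB r (2 * n + 1) = 4 * ((n : ℝ) + 1) ^ 2 * r ^ 2 := by
  simp [numB, show (2 * n + 1) / 2 = n by omega]

theorem denB_two_mul (z : ℝ) (n : ℕ) : denB z (2 * n) = 1 := by simp [denB]

theorem denB_two_mul_add_one (z : ℝ) (n : ℕ) : denB z (2 * n + 1) = z := by
  simp [denB, Nat.add_mod]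

/-- Induction in steps of two: `B (n+2) ≥ a (n+1) * B n`, and `(n+2)² ≥ (n+1)(n+3)` supplies the
linear factor. The constant is what `n = 0` and `n = 1` allow. -/
theorem exists_le_dens_sq_cfA {x r : ℝ} (hx : 0 < x) (hr : 0 < r) :
    ∃ c > 0, ∀ n : ℕ, c * (n + 1) * ∏ k ∈ Finset.range n, numA r k ≤
      (seqContFract (numA r) fun _ => x).dens n ^ 2 := by
  refine ⟨min 1 (x ^ 2 / (2 * r ^ 2)), by positivity, fun n => ?_⟩
  set c := min 1 (x ^ 2 / (2 * r ^ 2))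
  have hc : 0 < c := by positivity
  induction n using Nat.twoStepInduction with
  | zero => simp [c]
  | one =>
    have h : c ≤ x ^ 2 / (2 * r ^ 2) := min_le_right _ _
    rw [le_div_iff₀ (by positivity)] at h
    rw [dens_one]
    simp only [numA, Finset.prod_range_one]
    push_cast
    linarith
  | more n h₀ _ =>
    have hB := dens_pos (numA_pos hr) (b := fun _ => x) (fun _ => hx)
    set P := ∏ k ∈ Finset.range n, numA r k with hP
    have hP₀ : 0 < P := Finset.prod_pos fun _ _ => numA_pos hr _
    have h : numA r (n + 1) * (seqContFract (numA r) fun _ => x).dens n ≤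
        (seqContFract (numA r) fun _ => x).dens (n + 2) := by
      rw [dens_add_two]
      have := mul_pos hx (hB (n + 1))
      linarith
    have ha := numA_pos hr (n + 1)
    have h2 := pow_le_pow_left₀ (mul_pos ha (hB n)).le h 2
    refine le_trans ?_ h2
    rw [mul_pow]
    refine le_trans ?_ (mul_le_mul_of_nonneg_left h₀ (sq_nonneg _))
    rw [Finset.prod_range_succ, Finset.prod_range_succ, ← hP]
    have e : numA r (n + 1) ^ 2 * (c * (n + 1) * P) -
        c * ((n + 2 : ℕ) + 1) * (P * numA r n * numA r (n + 1)) =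
        numA r (n + 1) * c * P * r ^ 2 * (n + 1) := by
      simp only [numA]; push_cast; ring
    have : 0 ≤ numA r (n + 1) * c * P * r ^ 2 * (n + 1) := by positivity
    linarith

theorem tendsto_invGap_cfA {x r : ℝ} (hx : 0 < x) (hr : 0 < r) :
    Tendsto (invGap (numA r) fun _ => x) atTop atTop := by
  obtain ⟨c, hc, hle⟩ := exists_le_dens_sq_cfA hx hr
  -- Dividing the linear factor `n + 2` by `a (n+1) = (n+2)² r²` leaves a harmonic series.
  refine tendsto_invGap_of_not_summable (numA_pos hr) (fun _ => hx)
    (d := fun n => x * c / r ^ 2 * (1 / ((n + 2 : ℕ) : ℝ))) (fun n => by positivity) ?_ fun n => ?_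
  · rw [summable_mul_left_iff (by positivity), summable_nat_add_iff (f := fun n : ℕ => 1 / (n : ℝ)) 2]
    exact Real.not_summable_one_div_natCast
  · have hP : 0 < ∏ k ∈ Finset.range (n + 1), numA r k := Finset.prod_pos fun _ _ => numA_pos hr _
    have h := hle (n + 1)
    have ha := numA_pos hr (n + 1)
    rw [Finset.prod_range_succ _ (n + 1), le_div_iff₀ (by positivity)]
    refine le_trans (le_of_eq ?_) (mul_le_mul_of_nonneg_left h hx.le)
    simp only [numA]
    push_cast
    field_simp
    ring

theorem tendsto_invGap_cfB {z r : ℝ} (hz : 0 < z) (hr : 0 < r) :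
    Tendsto (invGap (numB r) (denB z)) atTop atTop := by
  set B := (seqContFract (numB r) (denB z)).dens with hBdef
  have hB : ∀ n, 0 < B n := dens_pos (numB_pos hr) (denB_pos hz)
  -- Numerators come in equal pairs, so `B (2m+3) ≥ a (2m+2) * B (2m+1)` matches the growth of the
  -- product; the even-indexed increments then stay bounded below.
  have hle : ∀ m, (∏ k ∈ Finset.range (2 * m + 2), numB r k) ≤
      (4 * r ^ 2) ^ 2 * B (2 * m + 1) ^ 2 := fun m => by
    induction m with
    | zero =>
      have h₀ := numB_two_mul r 0
      have h₁ := numB_two_mul_add_one r 0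
      have hd := denB_two_mul z 0
      simp only [mul_zero, zero_add, Nat.cast_zero] at h₀ h₁ hd
      rw [mul_zero, zero_add, zero_add, hBdef, dens_one, hd, Finset.prod_range_succ,
        Finset.prod_range_one, h₀, h₁]
      exact le_of_eq (by ring)
    | succ m ih =>
      rw [show 2 * (m + 1) = 2 * m + 2 by ring, Finset.prod_range_succ, Finset.prod_range_succ]
      have h₀ := numB_two_mul r (m + 1)
      have h₁ := numB_two_mul_add_one r (m + 1)
      rw [show 2 * (m + 1) = 2 * m + 2 by ring] at h₀ h₁
      rw [h₁, ← h₀]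
      have ha := numB_pos hr (2 * m + 2)
      have h : numB r (2 * m + 2) * B (2 * m + 1) ≤ B (2 * m + 2 + 1) := by
        rw [hBdef, dens_add_two]
        have := mul_pos (denB_pos hz (2 * m + 2)) (hB (2 * m + 2))
        simp only [← hBdef]
        linarith
      have h2 := pow_le_pow_left₀ (mul_pos ha (hB _)).le h 2
      calc _ = (∏ k ∈ Finset.range (2 * m + 2), numB r k) * numB r (2 * m + 2) ^ 2 := by ring
        _ ≤ (4 * r ^ 2) ^ 2 * B (2 * m + 1) ^ 2 * numB r (2 * m + 2) ^ 2 := by gcongr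
        _ = (4 * r ^ 2) ^ 2 * (numB r (2 * m + 2) * B (2 * m + 1)) ^ 2 := by ring
        _ ≤ _ := by gcongr
  refine tendsto_invGap_of_not_summable (numB_pos hr) (denB_pos hz)
    (d := fun n => if n % 2 = 0 then z / (4 * r ^ 2) ^ 2 else 0)
    (fun n => by split_ifs <;> positivity) (fun hs => ?_) fun n => ?_
  · have ht := hs.tendsto_atTop_zero.comp (tendsto_id.const_mul_atTop' (r := 2) two_pos)
    have he : ((fun n : ℕ => if n % 2 = 0 then z / (4 * r ^ 2) ^ 2 else 0) ∘ fun n => 2 * id n) =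
        fun _ => z / (4 * r ^ 2) ^ 2 := by
      funext n; simp
    rw [he] at ht
    have hpos : 0 < z / (4 * r ^ 2) ^ 2 := by positivity
    exact hpos.ne' (tendsto_nhds_unique tendsto_const_nhds ht)
  · have hP : 0 < ∏ k ∈ Finset.range (n + 2), numB r k := Finset.prod_pos fun _ _ => numB_pos hr _
    rcases Nat.even_or_odd' n with ⟨m, rfl | rfl⟩
    · rw [if_pos (by omega), denB_two_mul_add_one, div_le_div_iff₀ (by positivity) hP]
      have := mul_le_mul_of_nonneg_left (hle m) hz.le
      linarith
    · rw [if_neg (by omega)]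
      have := denB_pos hz (2 * m + 1 + 1)
      positivity

theorem cfA_facts {x r : ℝ} (hx : 0 < x) (hr : 0 < r) :
    CFConverges (cfA x r) ∧ (∃ W, IsPosSol (numA r) (fun _ => x) W) ∧
      ∀ W, IsPosSol (numA r) (fun _ => x) W → cfValue (cfA x r) = W 1 / W 0 :=
  converges_and_value (numA_pos hr) (fun _ => hx) (tendsto_invGap_cfA hx hr)

theorem cfB_facts {z r : ℝ} (hz : 0 < z) (hr : 0 < r) :
    CFConverges (cfB z r) ∧ (∃ W, IsPosSol (numB r) (denB z) W) ∧
      ∀ W, IsPosSol (numB r) (denB z) W → cfValue (cfB z r) = W 1 / W 0 := by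
  rw [cfB_eq]
  exact converges_and_value (numB_pos hr) (denB_pos hz) (tendsto_invGap_cfB hz hr)

theorem cfValue_cfA_pos {x r : ℝ} (hx : 0 < x) (hr : 0 < r) : 0 < cfValue (cfA x r) := by
  obtain ⟨-, ⟨W, hW⟩, hv⟩ := cfA_facts hx hr
  rw [hv W hW]
  exact div_pos (hW.pos 1) (hW.pos 0)

theorem cfValue_cfB_pos {z r : ℝ} (hz : 0 < z) (hr : 0 < r) : 0 < cfValue (cfB z r) := by
  obtain ⟨-, ⟨W, hW⟩, hv⟩ := cfB_facts hz hr
  rw [hv W hW]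
  exact div_pos (hW.pos 1) (hW.pos 0)

/-! ### The shift from `x + 2r` to `x`. -/

/-- The coefficients make the new recurrence a combination of two consecutive old ones. -/
theorem isPosSol_shift_cfA {x r : ℝ} (hx : 0 < x) (hr : 0 < r) {W : ℕ → ℝ}
    (hW : IsPosSol (numA r) (fun _ => x + 2 * r) W) :
    IsPosSol (numA r) (fun _ => x) fun n => (x + (2 * n + 3) * r) * W n + 2 * W (n + 1) where
  pos n := by
    have := hW.pos n
    have := hW.pos (n + 1)
    positivity
  rec_eq n := by
    have h₀ := hW.rec_eq n
    have h₁ := hW.rec_eq (n + 1)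
    simp only [numA] at h₀ h₁ ⊢
    push_cast at h₀ h₁ ⊢
    linear_combination (x + (2 * n + 3) * r) * h₀ + 2 * h₁

theorem isPosSol_shift_cfB {x r : ℝ} (hx : r < x) (hr : 0 < r) {W : ℕ → ℝ}
    (hW : IsPosSol (numB r) (denB ((x + 2 * r) ^ 2 - r ^ 2)) W) :
    IsPosSol (numB r) (denB (x ^ 2 - r ^ 2)) fun k =>
      if k % 2 = 0 then (x + r) * (x + (2 * k + 5) * r) * W k + 2 * W (k + 1)
      else (x + r) * (x + (2 * k + 3) * r) * W k + 2 * (x + r) ^ 2 * W (k + 1) where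
  pos k := by
    have := hr.trans hx
    have := hW.pos k
    have := hW.pos (k + 1)
    split_ifs <;> positivity
  rec_eq k := by
    rcases Nat.even_or_odd' k with ⟨n, rfl | rfl⟩
    · have h₀ := hW.rec_eq (2 * n)
      have h₁ := hW.rec_eq (2 * n + 1)
      rw [if_pos (by omega), if_neg (by omega), if_pos (by omega)]
      rw [numB_two_mul, denB_two_mul] at h₀ ⊢
      rw [numB_two_mul_add_one, denB_two_mul_add_one] at h₁
      push_cast
      linear_combination (x + r) * (x + (4 * n + 5) * r) * h₀ + 2 * h₁
    · have h₀ := hW.rec_eq (2 * n + 1)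
      have h₁ := hW.rec_eq (2 * (n + 1))
      rw [if_neg (by omega), if_pos (by omega), if_neg (by omega)]
      rw [numB_two_mul_add_one, denB_two_mul_add_one] at h₀ ⊢
      rw [numB_two_mul, denB_two_mul] at h₁
      simp only [show 2 * (n + 1) = 2 * n + 2 by ring] at h₁
      push_cast at h₁ ⊢
      linear_combination (x + r) * (x + (4 * n + 5) * r) * h₀ + 2 * (x + r) ^ 2 * h₁

theorem shift_equation_cfA {x r : ℝ} (hx : 0 < x) (hr : 0 < r) :
    1 / (x + cfValue (cfA x r)) + 1 / (x + 2 * r + cfValue (cfA (x + 2 * r) r)) =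
      2 / (x + r) := by
  obtain ⟨-, ⟨W, hW⟩, hv'⟩ := cfA_facts (x := x + 2 * r) (by positivity) hr
  rw [hv' W hW, (cfA_facts hx hr).2.2 _ (isPosSol_shift_cfA hx hr hW)]
  have h := hW.rec_eq 0
  have h₀ := hW.pos 0
  have h₁ := hW.pos 1
  have h₂ := hW.pos 2
  simp only [numA] at h
  push_cast at h ⊢
  norm_num at h ⊢
  -- Both reciprocals acquire the common factor `N`, which cancels in their sum.
  set N := (x + 2 * r) * W 0 + W 1 with hN
  have hN₀ : 0 < N := by positivity
  have hV : 0 < (x + 3 * r) * W 0 + 2 * W 1 := by positivity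
  have e₁ : x + ((x + 5 * r) * W 1 + 2 * W 2) / ((x + 3 * r) * W 0 + 2 * W 1) =
      (x + r) * N / ((x + 3 * r) * W 0 + 2 * W 1) := by
    rw [eq_div_iff hV.ne', add_mul, div_mul_cancel₀ _ hV.ne']
    linear_combination -2 * h
  have e₂ : x + 2 * r + W 1 / W 0 = N / W 0 := by
    rw [eq_div_iff h₀.ne', add_mul, div_mul_cancel₀ _ h₀.ne']
  rw [e₁, e₂, inv_div, inv_div]
  field_simp
  rw [hN]
  ring

theorem shift_equation_cfB {x r : ℝ} (hx : r < x) (hr : 0 < r) :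
    1 / (x ^ 2 - r ^ 2 + cfValue (cfB (x ^ 2 - r ^ 2) r)) +
      1 / ((x + 2 * r) ^ 2 - r ^ 2 + cfValue (cfB ((x + 2 * r) ^ 2 - r ^ 2) r)) =
      2 / (x + r) ^ 2 := by
  have hx₀ := hr.trans hx
  have hz : 0 < x ^ 2 - r ^ 2 := by nlinarith
  have hz' : 0 < (x + 2 * r) ^ 2 - r ^ 2 := by nlinarith
  obtain ⟨-, ⟨W, hW⟩, hv'⟩ := cfB_facts hz' hr
  rw [hv' W hW, (cfB_facts hz hr).2.2 _ (isPosSol_shift_cfB hx hr hW)]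
  have h := hW.rec_eq 0
  have h₀ := hW.pos 0
  have h₁ := hW.pos 1
  have h₂ := hW.pos 2
  simp only [numB, denB] at h
  norm_num at h ⊢
  set N := ((x + 2 * r) ^ 2 - r ^ 2) * W 0 + W 1 with hN
  have hN₀ : 0 < N := by positivity
  set V := (x + r) * (x + 5 * r) * W 0 + 2 * W 1 with hV
  have hV₀ : 0 < V := by positivity
  have e₁ : x ^ 2 - r ^ 2 + ((x + r) * (x + 5 * r) * W 1 + 2 * (x + r) ^ 2 * W 2) / V =
      (x + r) ^ 2 * N / V := by
    rw [eq_div_iff hV₀.ne', add_mul, div_mul_cancel₀ _ hV₀.ne', hN, hV]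
    linear_combination -2 * (x + r) ^ 2 * h
  have e₂ : (x + 2 * r) ^ 2 - r ^ 2 + W 1 / W 0 = N / W 0 := by
    rw [eq_div_iff h₀.ne', add_mul, div_mul_cancel₀ _ h₀.ne']
  rw [e₁, e₂, inv_div, inv_div]
  field_simp
  rw [hN, hV]
  ring

/-! ### The derivative formula and its special cases. -/

theorem hasDerivAt_cfA {x r : ℝ} (hr : 0 < r) (hx : r < x) :
    HasDerivAt (fun y => 1 / (y + cfValue (cfA y r)))
      (-(1 / (x ^ 2 - r ^ 2 + cfValue (cfB (x ^ 2 - r ^ 2) r)))) x := by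
  refine hasDerivAt_of_shift_equations (F := fun y => 1 / (y + cfValue (cfA y r)))
    (h := fun y => 1 / (y ^ 2 - r ^ 2 + cfValue (cfB (y ^ 2 - r ^ 2) r))) hr hx
    (fun y hy => shift_equation_cfA hy hr) ?_ (fun y hy => shift_equation_cfB hy hr) ?_
  · simp only [one_div]
    refine (tendsto_atTop_mono' _ ?_ tendsto_id).inv_tendsto_atTop
    filter_upwards [eventually_gt_atTop 0] with y hy
    exact le_add_of_nonneg_right (cfValue_cfA_pos hy hr).le
  · simp only [one_div]
    refine (tendsto_atTop_mono' _ ?_ (tendsto_atTop_add_const_right _ (-r ^ 2)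
      (tendsto_pow_atTop (α := ℝ) two_ne_zero))).inv_tendsto_atTop
    filter_upwards [eventually_gt_atTop r] with y hy
    have := cfValue_cfB_pos (z := y ^ 2 - r ^ 2) (by nlinarith) hr
    linarith

theorem cf_facts {x r : ℝ} (hr : 0 < r) (hx : r < x) :
    CFConverges (cfA x r) ∧ 0 < x + cfValue (cfA x r) ∧
      CFConverges (cfB (x ^ 2 - r ^ 2) r) ∧
      0 < x ^ 2 - r ^ 2 + cfValue (cfB (x ^ 2 - r ^ 2) r) := by
  have hz : 0 < x ^ 2 - r ^ 2 := by nlinarith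
  have hx₀ := hr.trans hx
  exact ⟨(cfA_facts hx₀ hr).1, add_pos hx₀ (cfValue_cfA_pos hx₀ hr), (cfB_facts hz hr).1,
    add_pos hz (cfValue_cfB_pos hz hr)⟩

theorem lemma6 :
    -- the general formula, for `φ(s, r) = s + ψ(r)`
    (∀ ψ : ℝ → ℝ, ∀ φ : ℝ → ℝ → ℝ, (∀ s r : ℝ, φ s r = s + ψ r) →
      ∀ f : ℝ → ℝ → ℝ, (∀ s r : ℝ, f s r = 1 / (φ s r + cfValue (cfA (φ s r) r))) →
      ∀ r s : ℝ, 0 < r → r - ψ r < s →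
        CFConverges (cfA (φ s r) r) ∧
        φ s r + cfValue (cfA (φ s r) r) ≠ 0 ∧
        CFConverges (cfB (φ s r ^ 2 - r ^ 2) r) ∧
        φ s r ^ 2 - r ^ 2 + cfValue (cfB (φ s r ^ 2 - r ^ 2) r) ≠ 0 ∧
        HasDerivAt (fun t : ℝ => f t r)
          (-(1 / (φ s r ^ 2 - r ^ 2 + cfValue (cfB (φ s r ^ 2 - r ^ 2) r)))) s) ∧
    -- the two special cases
    (∀ f₁ f₂ : ℝ → ℝ → ℝ,
      (∀ s r : ℝ, f₁ s r = 1 / (2 - 2 * r + 2 * s + 2 * cfValue (cfA (1 - r + s) r))) →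
      (∀ s r : ℝ, f₂ s r = 1 / (2 * r - 2 + 2 * s + 2 * cfValue (cfA (r - 1 + s) r))) →
      ∀ r s : ℝ, 0 < r → max 1 (2 * r - 1) < s →
        (CFConverges (cfA (1 - r + s) r) ∧
          2 - 2 * r + 2 * s + 2 * cfValue (cfA (1 - r + s) r) ≠ 0 ∧
          CFConverges (cfB ((1 - 2 * r + s) * (1 + s)) r) ∧
          2 * (1 - 2 * r + s) * (1 + s)
            + 2 * cfValue (cfB ((1 - 2 * r + s) * (1 + s)) r) ≠ 0 ∧
          HasDerivAt (fun t : ℝ => f₁ t r)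
            (-(1 / (2 * (1 - 2 * r + s) * (1 + s)
              + 2 * cfValue (cfB ((1 - 2 * r + s) * (1 + s)) r)))) s) ∧
        (CFConverges (cfA (r - 1 + s) r) ∧
          2 * r - 2 + 2 * s + 2 * cfValue (cfA (r - 1 + s) r) ≠ 0 ∧
          CFConverges (cfB ((2 * r - 1 + s) * (s - 1)) r) ∧
          2 * (2 * r - 1 + s) * (s - 1)
            + 2 * cfValue (cfB ((2 * r - 1 + s) * (s - 1)) r) ≠ 0 ∧
          HasDerivAt (fun t : ℝ => f₂ t r)
            (-(1 / (2 * (2 * r - 1 + s) * (s - 1)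
              + 2 * cfValue (cfB ((2 * r - 1 + s) * (s - 1)) r)))) s)) := by
  refine ⟨fun ψ φ hφ f hf r s hr hs => ?_, fun f₁ f₂ h₁ h₂ r s hr hs => ?_⟩
  · have hx : r < φ s r := by rw [hφ]; linarith
    obtain ⟨hA, hA₀, hB, hB₀⟩ := cf_facts hr hx
    refine ⟨hA, hA₀.ne', hB, hB₀.ne', ?_⟩
    have h := hasDerivAt_cfA hr hx
    simp only [hφ] at h hf ⊢
    simp only [hf]
    exact h.comp_add_const s (ψ r)
  · obtain ⟨hs₁, hs₂⟩ := max_lt_iff.1 hs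
    constructor
    · have hx : r < 1 - r + s := by linarith
      have hz : (1 - r + s) ^ 2 - r ^ 2 = (1 - 2 * r + s) * (1 + s) := by ring
      obtain ⟨hA, hA₀, hB, hB₀⟩ := cf_facts hr hx
      have h := hasDerivAt_cfA hr hx
      rw [hz] at hB hB₀ h
      refine ⟨hA, by linarith, hB, by linarith, ?_⟩
      -- `f₁` is half of `F` at `1 - r + s`.
      have hd := (HasDerivAt.comp_const_add (1 - r) s h).const_mul (1 / 2)
      refine (hd.congr_deriv ?_).congr_of_eventuallyEq (Eventually.of_forall fun t => ?_)
      · rw [mul_assoc, ← mul_add, mul_neg, one_div_mul_one_div]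
      · dsimp only
        rw [h₁, one_div_mul_one_div]
        ring_nf
    · have hx : r < r - 1 + s := by linarith
      have hz : (r - 1 + s) ^ 2 - r ^ 2 = (2 * r - 1 + s) * (s - 1) := by ring
      obtain ⟨hA, hA₀, hB, hB₀⟩ := cf_facts hr hx
      have h := hasDerivAt_cfA hr hx
      rw [hz] at hB hB₀ h
      refine ⟨hA, by linarith, hB, by linarith, ?_⟩
      have hd := (HasDerivAt.comp_const_add (r - 1) s h).const_mul (1 / 2)
      refine (hd.congr_deriv ?_).congr_of_eventuallyEq (Eventually.of_forall fun t => ?_)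
      · rw [mul_assoc, ← mul_add, mul_neg, one_div_mul_one_div]
      · dsimp only
        rw [h₂, one_div_mul_one_div]
        ring_nf
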